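/- Let $q$ be a prime power, $m\ge 1$, and let $g_1,g_2,v_1,v_2\in\mathbb F_{q^2}[x]$ with $g_1,g_2$ monic divisors of $x^m-1$ and $\gcd(v_1v_2-1,\,x^m-1)=1$. For a polynomial $k$ over $\mathbb F_{q^2}$ let $k^{[q]}$ be obtained by raising every coefficient to the $q$-th power, let $\overline{k}(x)=k(x^{-1}) \bmod (x^m-1)$ (with $x^{-1}=x^{m-1}$), and let $[k]\in\mathbb F_{q^2}^m$ be the coefficient vector of $k \bmod (x^m-1)$. Put $h_i=(x^m-1)/g_i$. Let $\mathcal C\subseteq\mathbb F_{q^2}^{2m}$ be the quasi-cyclic code generated by $([g_1],[v_1g_1])$ and $([v_2g_2],[g_2])$, i.e. the set of all $([ag_1+bv_2g_2],[av_1g_1+bg_2])$ with $a,b\in\mathbb F_{q^2}[x]$, and let $\mathcal C^{\perp_H}=\{u : \sum_i u_i^q c_i=0 \ \forall c\in\mathcal C\}$. Suppose that $$(1)\ h_1^{[q]}\mid \overline{g_1}\,\bigl(1+v_1^{[q]}\,\overline{v_1}\bigr),\qquad (2)\ h_1^{[q]}\mid \overline{g_2}\,\bigl(\overline{v_2}+v_1^{[q]}\bigr),\qquad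 (3)\ h_2^{[q]}\mid \overline{g_2}\,\bigl(v_2^{[q]}\,\overline{v_2}+1\bigr).$$ Then $\mathcal C$ is Hermitian self-orthogonal, $\mathcal C\subseteq\mathcal C^{\perp_H}$, of length $2m$ and dimension $2m-\deg g_1-\deg g_2$ over $\mathbb F_{q^2}$. In particular $\deg g_1+\deg g_2\ge m$. Moreover there exists a quantum stabilizer code with parameters $$[[\,2m,\ 2(\deg g_1+\deg g_2-m),\ d\,]]_q,\qquad d=w(\mathcal C^{\perp_H}\setminus\mathcal C),$$ where $w$ denotes the minimum Hamming weight; when $\mathcal C^{\perp_H}=\mathcal C$, $d$ is the minimum weight of $\mathcal C^{\perp_H}\setminus\{0\}$. Here an $[[n,k,d]]_q$ stabilizer code is a nonzero joint eigenspace $Q\subseteq(\mathbb C^{q})^{\otimes n}$, of dimension $q^k$, of an abelian subgroup of the error group $\{\omega^cX(a)Z(b): c\in\mathbb F_p,\ a,b\in\mathbb F_q^n\}$, where $p=\operatorname{char}\mathbb F_q$, $\omega=e^{2\pi i/p}$, $X(a)|x\rangle=|x+a\rangle$ and $Z(b)|x\rangle=\omega^{\operatorname{tr}(b\cdot x)}|x\rangle$,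 with minimum distance $d$. The weight of $\omega^cX(a)Z(b)$ is the number of $i$ with $(a_i,b_i)\ne(0,0)$. For $k>0$, minimum distance $d$ means that $Q$ detects all errors of weight less than $d$ and fails to detect some error of weight $d$ ($E$ is detected if $\langle u|E|v\rangle=s_E\langle u|v\rangle$ for all $u,v\in Q$, with $s_E$ depending only on $E$). For $k=0$, $d$ is by convention the least positive weight of an error $E$ with $\langle u|E|v\rangle\neq0$ for some $u,v\in Q$. -/

import Mathlib

open Polynomial

noncomputable section

namespace QCStab

/-! ### Polynomials modulo `x ^ m - 1` -/

section Poly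

variable {F : Type*} [Field F]

/-- `k̄(x) = k(x⁻¹) mod (x ^ m - 1)`, where `x⁻¹ = x ^ (m - 1)`, as a reduced polynomial. -/
def bar (m : ℕ) (k : F[X]) : F[X] := (k.comp (X ^ (m - 1))) %ₘ (X ^ m - 1)

/-- `h(x) = (x ^ m - 1) / g(x)`. -/
def parityPoly (m : ℕ) (g : F[X]) : F[X] := (X ^ m - 1) / g

/-- `k^{[q]}(x)`: every coefficient raised to the power `q = #K`. -/
def coeffPow (K : Type*) [Field K] [Fintype K] [Algebra K F] (k : F[X]) : F[X] :=
  k.map (FiniteField.frobeniusAlgHom K F).toRingHom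

/-- `[k(x)]`: the coefficient vector of the residue of `k` modulo `x ^ m - 1`. -/
def coeffVec (m : ℕ) (k : F[X]) : Fin m → F := fun i => (k %ₘ (X ^ m - 1)).coeff i

/-- The QC code of index `l` and length `m * l` generated by the rows
`([k s 0], …, [k s (l-1)])`: the span of the words
`([r k s 0], …, [r k s (l-1)])` for all polynomials `r` and all rows `s`.
Coordinate `(j, i)` is the coefficient of `x ^ i` in the `j`-th block. -/
def qcCode (m : ℕ) {t l : ℕ} (k : Fin t → Fin l → F[X]) :
    Submodule F (Fin l × Fin m → F) :=
  Submodule.span F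
    {w | ∃ (r : F[X]) (s : Fin t), w = fun ji => coeffVec m (r * k s ji.1) ji.2}

/-- The code generated by `([g₁], [v₁ g₁])` and `([v₂ g₂], [g₂])`. -/
def twoGenCode (m : ℕ) (g₁ g₂ v₁ v₂ : F[X]) : Submodule F (Fin 2 × Fin m → F) :=
  qcCode m ![![g₁, v₁ * g₁], ![v₂ * g₂, g₂]]

end Poly

/-! ### The Hermitian dual -/

section Hermitian

variable (K : Type*) [Field K] [Fintype K] {F : Type*} [Field F] [Algebra K F]
variable {ι : Type*} [Fintype ι]

/-- `⟨u, v⟩_H = ∑ i, u i ^ q * v i` with `q = #K`. -/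
def hermInner (u v : ι → F) : F := ∑ i, u i ^ Fintype.card K * v i

/-- `C^{⊥_H} = {u | ⟨u, c⟩_H = 0 for all c ∈ C}`. -/
def hermDual (C : Submodule F (ι → F)) : Submodule F (ι → F) where
  carrier := {u | ∀ c ∈ C, hermInner K u c = 0}
  add_mem' := by
    intro a b ha hb c hc
    have h : hermInner K (a + b) c = hermInner K a c + hermInner K b c := by
      have hp : ∀ x y : F, (x + y) ^ Fintype.card K
          = x ^ Fintype.card K + y ^ Fintype.card K := fun x y =>
        map_add (FiniteField.frobeniusAlgHom K F) x y
      simp only [hermInner, Pi.add_apply, hp, add_mul, Finset.sum_add_distrib]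
    rw [h, ha c hc, hb c hc, add_zero]
  zero_mem' := by
    intro c _
    simp [hermInner, Fintype.card_ne_zero]
  smul_mem' := by
    intro r a ha c hc
    have h : hermInner K (r • a) c = r ^ Fintype.card K * hermInner K a c := by
      simp only [hermInner, Pi.smul_apply, smul_eq_mul, mul_pow, Finset.mul_sum, mul_assoc]
    rw [h, ha c hc, mul_zero]

/-- The set of words whose minimum weight is the distance attached to `C`: it is
`C^{⊥_H} \ C`, or `C^{⊥_H} \ {0}` in the self-dual case, where the former set is empty. -/
def distanceWords (C : Submodule F (ι → F)) : Set (ι → F) :=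
  {w | w ∈ hermDual K C ∧ (w ∉ C ∨ (hermDual K C = C ∧ w ≠ 0))}

end Hermitian

/-! ### Quantum stabilizer codes

The Hilbert space of `n = #ι` qudits is `ℂ^{q^n}`, written `(ι → K) → ℂ`, with orthonormal
basis `|x⟩`, `x ∈ K^ι`, and inner product `⟨u, v⟩ = star u ⬝ᵥ v`. -/

section Quantum

set_option linter.unusedSectionVars false

variable (p : ℕ) [Fact p.Prime] {K : Type*} [Field K] [Fintype K] [Algebra (ZMod p) K]
variable {ι : Type*} [Fintype ι]

/-- `ω ^ c` with `ω = exp(2πi/p)`. -/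
def phase (c : ZMod p) : ℂ := ZMod.stdAddChar c

/-- The exponent `tr(b · x)`, with `tr` the trace from `K` to the prime field. -/
def trDot (b x : ι → K) : ZMod p := Algebra.trace (ZMod p) K (∑ i, b i * x i)

lemma phase_add (c d : ZMod p) : phase p (c + d) = phase p c * phase p d :=
  AddChar.map_add_eq_mul _ c d

lemma phase_zero : phase p 0 = 1 := AddChar.map_zero_eq_one _

lemma trDot_add (b x y : ι → K) : trDot p b (x + y) = trDot p b x + trDot p b y := by
  simp [trDot, mul_add, Finset.sum_add_distrib]

lemma add_trDot (b c x : ι → K) : trDot p (b + c) x = trDot p b x + trDot p c x := by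
  simp [trDot, add_mul, Finset.sum_add_distrib]

lemma trDot_neg (b x : ι → K) : trDot p b (-x) = -trDot p b x := by
  simp [trDot, Finset.sum_neg_distrib]

lemma neg_trDot (b x : ι → K) : trDot p (-b) x = -trDot p b x := by
  simp [trDot, Finset.sum_neg_distrib]

lemma zero_trDot (x : ι → K) : trDot p (0 : ι → K) x = 0 := by
  simp [trDot]

/-- The error `ω ^ c X(a) Z(b)`, where `X(a)|x⟩ = |x + a⟩` and
`Z(b)|x⟩ = ω ^ tr(b · x) |x⟩`. In coordinates:
`(ω ^ c X(a) Z(b) f)(x) = ω ^ (c + tr(b · (x - a))) f(x - a)`. -/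
def errorOp (c : ZMod p) (a b : ι → K) : ((ι → K) → ℂ) ≃ₗ[ℂ] ((ι → K) → ℂ) where
  toFun f x := phase p (c + trDot p b (x - a)) * f (x - a)
  invFun f x := phase p (-(c + trDot p b x)) * f (x + a)
  map_add' f g := by
    ext x
    simp [mul_add]
  map_smul' r f := by
    ext x
    simp [mul_left_comm]
  left_inv f := by
    ext x
    simp [← mul_assoc, ← phase_add, phase_zero]
  right_inv f := by
    ext x
    simp [← mul_assoc, ← phase_add, phase_zero]

lemma errorOp_apply (c : ZMod p) (a b : ι → K) (f : (ι → K) → ℂ) (x : ι → K) :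
    errorOp p c a b f x = phase p (c + trDot p b (x - a)) * f (x - a) := rfl

lemma errorOp_mul (c c' : ZMod p) (a b a' b' : ι → K) :
    errorOp p c a b * errorOp p c' a' b'
      = errorOp p (c + c' + trDot p b a') (a + a') (b + b') := by
  ext f x
  simp only [LinearEquiv.mul_apply, errorOp_apply, ← mul_assoc, ← phase_add]
  rw [show x - a - a' = x - (a + a') by abel]
  congr 2
  rw [show x - a = (x - (a + a')) + a' by abel, trDot_add, add_trDot]
  ring

lemma errorOp_one : errorOp p 0 (0 : ι → K) 0 = 1 := by
  ext f x
  simp [errorOp_apply, zero_trDot, phase_zero]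

/-- The error group `{ω ^ c X(a) Z(b)}`. -/
def errorGroup (K : Type*) [Field K] [Fintype K] [Algebra (ZMod p) K] (ι : Type*) [Fintype ι] :
    Subgroup (((ι → K) → ℂ) ≃ₗ[ℂ] ((ι → K) → ℂ)) where
  carrier := {E | ∃ (c : ZMod p) (a b : ι → K), E = errorOp p c a b}
  mul_mem' := by
    rintro _ _ ⟨c, a, b, rfl⟩ ⟨c', a', b', rfl⟩
    exact ⟨_, _, _, errorOp_mul p c c' a b a' b'⟩
  one_mem' := ⟨0, 0, 0, (errorOp_one p).symm⟩
  inv_mem' := by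
    rintro _ ⟨c, a, b, rfl⟩
    refine ⟨-c + trDot p b a, -a, -b, inv_eq_of_mul_eq_one_right ?_⟩
    rw [errorOp_mul, trDot_neg, add_neg_cancel, add_neg_cancel, ← errorOp_one p]
    congr 1
    ring

/-- The weight of `ω ^ c X(a) Z(b)`: the number of qudits on which it acts nontrivially. -/
def errorWeight (a b : ι → K) : ℕ := Nat.card {i : ι // (a i, b i) ≠ (0, 0)}

/-- `Q` is a stabilizer code: a nonzero joint eigenspace of an abelian subgroup of the
error group (`χ E` is the eigenvalue of `E`). -/
def IsStabilizerCode (Q : Submodule ℂ ((ι → K) → ℂ)) : Prop :=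
  Q ≠ ⊥ ∧ ∃ S : Subgroup (((ι → K) → ℂ) ≃ₗ[ℂ] ((ι → K) → ℂ)),
    S ≤ errorGroup p K ι ∧ (∀ E ∈ S, ∀ E' ∈ S, E * E' = E' * E) ∧
    ∃ χ : (((ι → K) → ℂ) ≃ₗ[ℂ] ((ι → K) → ℂ)) → ℂ,
      ∀ f, f ∈ Q ↔ ∀ E ∈ S, E f = χ E • f

variable [DecidableEq ι]

/-- `Q` detects the error `E`: `⟨u, E v⟩ = s ⟨u, v⟩` on `Q`, for a scalar `s` depending only
on `E`; that is, `P E P = s P` for the orthogonal projector `P` onto `Q`. -/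
def Detects (Q : Submodule ℂ ((ι → K) → ℂ))
    (E : ((ι → K) → ℂ) ≃ₗ[ℂ] ((ι → K) → ℂ)) : Prop :=
  ∃ s : ℂ, ∀ u ∈ Q, ∀ v ∈ Q, star u ⬝ᵥ E v = s * (star u ⬝ᵥ v)

/-- `Q` is an `[[n, k, d]]_q` stabilizer code, `q = #K`: it encodes `k` qudits into `n`, it
detects all errors of weight less than `d`, and not all errors of weight `d`.
A one-dimensional code (`k = 0`) detects every error; there, as usual, `d` is the least weight
of a nontrivial error `E` with `⟨u, E v⟩ ≠ 0` for some `u, v` in the code. -/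
structure IsStabilizerCodeWithParams (n k d : ℕ) (Q : Submodule ℂ ((ι → K) → ℂ)) : Prop where
  length : Fintype.card ι = n
  stabilizer : IsStabilizerCode p Q
  dim : Module.finrank ℂ Q = Fintype.card K ^ k
  minDist : k ≠ 0 →
    IsLeast {w | ∃ (c : ZMod p) (a b : ι → K),
      errorWeight a b = w ∧ ¬ Detects Q (errorOp p c a b)} d
  minDist_zero : k = 0 →
    IsLeast {w | ∃ (c : ZMod p) (a b : ι → K), errorWeight a b = w ∧ w ≠ 0 ∧
      ∃ u ∈ Q, ∃ v ∈ Q, star u ⬝ᵥ errorOp p c a b v ≠ 0} d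

end Quantum

end QCStab

end

open Polynomial

noncomputable section

namespace QCStab

/-! ### Arithmetic modulo `X ^ m - 1` -/

section Cyclic

variable {F : Type*} [Field F] {m : ℕ}

/-! Self-orthogonality: the Hermitian product of `[u]` and `[w]` is the constant coefficient of
`u^{[q]}(x) w(x⁻¹)` modulo `x^m - 1` (`hermInner_coeffVec`). Two generator rows therefore yield
orthogonal words once the blockwise sum of these products vanishes modulo `x^m - 1`. That sum is
`g₁^{[q]}` or `g₂^{[q]}` times the right side of (1), (2) or (3), and `g_i^{[q]} h_i^{[q]} = x^m -
1`. Coprimality gives the dimension: `(a, b)` yields the zero word exactly when `h₁ ∣ a` and `h₂ ∣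
b`.

Quantum code: for `γ ∈ F` outside `K`, the word `a + γ b` over `F` labels the error `X(a)Z(b)`.
Errors commute up to the trace-symplectic form, which is proportional, before the trace, to `⟨x,
y⟩_H - ⟨y, x⟩_H`; for an `F`-linear code its dual is thus the Hermitian dual
(`forall_symplForm_eq_zero_iff`). A self-orthogonal `C` gives commuting errors with a joint
eigenspace `Q`. Only the identity error has nonzero trace, so the trace of the projector gives `dim
Q = q^n / |C|`. An error outside the dual sends `Q` into its orthogonal complement, an error in `C`
is scalar on `Q`, and one in the dual but not in `C` preserves `Q` with trace zero and is not
detected. -/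

lemma monic_X_pow_sub_one (hm : 0 < m) : (X ^ m - 1 : F[X]).Monic := by
  simpa using monic_X_pow_sub_C (1 : F) hm.ne'

lemma X_pow_modByMonic (hm : 0 < m) (n : ℕ) :
    (X ^ n : F[X]) %ₘ (X ^ m - 1) = X ^ (n % m) := by
  have h : (X ^ m - 1 : F[X]) ∣ X ^ n - X ^ (n % m) := by
    have h1 : (X ^ m - 1 : F[X]) ∣ X ^ (m * (n / m)) - 1 := by
      rw [pow_mul]
      simpa using sub_dvd_pow_sub_pow (X ^ m : F[X]) 1 (n / m)
    have h2 : (X ^ n - X ^ (n % m) : F[X]) = X ^ (n % m) * (X ^ (m * (n / m)) - 1) := by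
      rw [mul_sub, ← pow_add, Nat.mod_add_div, mul_one]
    rw [h2]
    exact h1.mul_left _
  rw [modByMonic_eq_of_dvd_sub (monic_X_pow_sub_one hm) h,
    (modByMonic_eq_self_iff (monic_X_pow_sub_one hm))]
  have : (X ^ m - 1 : F[X]).degree = m := by simpa using degree_X_pow_sub_C hm (1 : F)
  rw [this, degree_X_pow]
  exact_mod_cast Nat.mod_lt n hm

/-- The reduced coefficient vector as a linear map. -/
def coeffVecLin (F : Type*) [Field F] (m : ℕ) : F[X] →ₗ[F] (Fin m → F) :=
  LinearMap.pi fun i => lcoeff F i ∘ₗ modByMonicHom (X ^ m - 1)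

lemma coeffVecLin_apply (k : F[X]) : coeffVecLin F m k = coeffVec m k := by
  ext i
  simp [coeffVecLin, coeffVec, modByMonicHom]

lemma coeffVec_X_pow (hm : 0 < m) (n : ℕ) (i : Fin m) :
    coeffVec m (X ^ n : F[X]) i = if (i : ℕ) = n % m then 1 else 0 := by
  rw [coeffVec, X_pow_modByMonic hm, coeff_X_pow]

lemma coeffVec_eq_zero_iff (hm : 0 < m) (k : F[X]) :
    coeffVec m k = 0 ↔ X ^ m - 1 ∣ k := by
  rw [← modByMonic_eq_zero_iff_dvd (monic_X_pow_sub_one hm)]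
  constructor
  · intro h
    ext n
    by_cases hn : n < m
    · simpa [coeffVec] using congrFun h ⟨n, hn⟩
    · rw [coeff_zero]
      apply coeff_eq_zero_of_degree_lt
      refine (degree_modByMonic_lt _ (monic_X_pow_sub_one hm)).trans_le ?_
      have : (X ^ m - 1 : F[X]).degree = m := by simpa using degree_X_pow_sub_C hm (1 : F)
      rw [this]
      exact_mod_cast not_lt.mp hn
  · intro h
    ext i
    simp [coeffVec, h]

lemma dvd_bar_sub_comp (k : F[X]) :
    X ^ m - 1 ∣ bar m k - k.comp (X ^ (m - 1)) := by
  refine ⟨-(k.comp (X ^ (m - 1)) /ₘ (X ^ m - 1)), ?_⟩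
  rw [bar]
  linear_combination modByMonic_add_div (k.comp (X ^ (m - 1))) (X ^ m - 1)

lemma mul_parityPoly (hm : 0 < m) {g : F[X]} (hd : g ∣ X ^ m - 1) : g * parityPoly m g = X ^ m - 1 :=
  EuclideanDomain.mul_div_cancel' 
    (fun h => (monic_X_pow_sub_one hm).ne_zero (zero_dvd_iff.mp (h ▸ hd))) hd

end Cyclic

/-! ### The Hermitian product as a polynomial coefficient -/

section Hermitian

variable (K : Type*) [Field K] [Fintype K] {F : Type*} [Field F] [Algebra K F] {m : ℕ}

lemma add_pow_card (x y : F) : (x + y) ^ Fintype.card K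
    = x ^ Fintype.card K + y ^ Fintype.card K :=
  map_add (FiniteField.frobeniusAlgHom K F) x y

lemma sum_pow_card {ι : Type*} (s : Finset ι) (f : ι → F) :
    (∑ i ∈ s, f i) ^ Fintype.card K = ∑ i ∈ s, f i ^ Fintype.card K :=
  map_sum (FiniteField.frobeniusAlgHom K F) f s

/-- Since `m - 1 ≡ -1` modulo `m`, adding `(m - 1) * j` subtracts `j`: the effect on exponents of
`x⁻¹ = x ^ (m - 1)`. -/
lemma mod_eq_mod_iff_add_sub_one_mul_mod (hm : 0 < m) (i j : ℕ) : i % m = j % m ↔ (i + (m - 1) * j) % m = 0 := by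
  have h : i + (m - 1) * j + j = i + m * j := by
    obtain ⟨n, rfl⟩ := Nat.exists_eq_add_of_lt hm
    simp only [zero_add, Nat.add_sub_cancel]
    ring
  constructor
  · intro hij
    have h1 : (i + (m - 1) * j + j) ≡ 0 + j [MOD m] := by
      rw [h, zero_add, Nat.ModEq, Nat.add_mul_mod_self_left, hij]
    simpa [Nat.ModEq] using Nat.ModEq.add_right_cancel' j h1
  · intro h0
    have h1 : (i + (m - 1) * j + j) ≡ 0 + j [MOD m] := Nat.ModEq.add_right j (by simpa [Nat.ModEq] using h0)
    rw [h, zero_add, Nat.ModEq, Nat.add_mul_mod_self_left] at h1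
    exact h1

/-- The Hermitian product of two coefficient vectors is a constant coefficient of a product
modulo `X ^ m - 1`. -/
lemma hermInner_coeffVec (hm : 0 < m) (u w : F[X]) :
    hermInner K (coeffVec m u) (coeffVec m w)
      = coeffVec m (coeffPow K u * w.comp (X ^ (m - 1))) ⟨0, hm⟩ := by
  have hadd : ∀ k l : F[X], coeffVec m (k + l) = coeffVec m k + coeffVec m l := fun k l => by
    simp only [← coeffVecLin_apply, map_add]
  have hsmul : ∀ (a : F) (k : F[X]), coeffVec m (C a * k) = a • coeffVec m k := fun a k => by
    simp only [← coeffVecLin_apply, ← smul_eq_C_mul, map_smul]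
  -- Both sides are additive in `u` and in `w`. For `a x^i` and `b x^j` both equal `a^q b` if `i ≡
  -- j` modulo `m`, and `0` otherwise.
  induction u using Polynomial.induction_on' with
  | add u u' hu hu' =>
    have : hermInner K (coeffVec m u + coeffVec m u') (coeffVec m w)
        = hermInner K (coeffVec m u) (coeffVec m w)
          + hermInner K (coeffVec m u') (coeffVec m w) := by
      simp only [hermInner, Pi.add_apply, add_pow_card, add_mul, Finset.sum_add_distrib]
    rw [hadd, this, hu, hu', coeffPow, coeffPow, coeffPow, Polynomial.map_add, add_mul, hadd,
      Pi.add_apply]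
  | monomial i a =>
    induction w using Polynomial.induction_on' with
    | add w w' hw hw' =>
      have : hermInner K (coeffVec m (monomial i a)) (coeffVec m w + coeffVec m w')
          = hermInner K (coeffVec m (monomial i a)) (coeffVec m w)
            + hermInner K (coeffVec m (monomial i a)) (coeffVec m w') := by
        simp only [hermInner, Pi.add_apply, mul_add, Finset.sum_add_distrib]
      rw [hadd, this, hw, hw', add_comp, mul_add, hadd, Pi.add_apply]
    | monomial j b =>
      have hprod : coeffPow K (monomial i a) * (monomial j b).comp (X ^ (m - 1))
          = C (a ^ Fintype.card K * b) * X ^ (i + (m - 1) * j) := by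
        rw [← C_mul_X_pow_eq_monomial, ← C_mul_X_pow_eq_monomial, mul_comp, C_comp, X_pow_comp,
          ← pow_mul, coeffPow, Polynomial.map_mul, map_C, Polynomial.map_pow, map_X, pow_add]
        have : (FiniteField.frobeniusAlgHom K F).toRingHom a = a ^ Fintype.card K := rfl
        rw [this, C_mul]
        ring
      rw [hprod, hsmul, Pi.smul_apply, coeffVec_X_pow hm, ← C_mul_X_pow_eq_monomial,
        ← C_mul_X_pow_eq_monomial, hsmul, hsmul, hermInner]
      simp only [Pi.smul_apply, coeffVec_X_pow hm, smul_eq_mul]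
      rw [Finset.sum_eq_single ⟨i % m, Nat.mod_lt i hm⟩]
      · have := mod_eq_mod_iff_add_sub_one_mul_mod hm i j
        by_cases h : i % m = j % m
        · simp [h, this.mp h]
        · have h' : (i + (m - 1) * j) % m ≠ 0 := fun h0 => h (this.mpr h0)
          simp [h, Ne.symm h']
      · intro x _ hx
        have : (x : ℕ) ≠ i % m := fun h => hx (Fin.ext h)
        simp [this, Fintype.card_ne_zero]
      · simp

end Hermitian

/-! ### Dimension of the Hermitian dual -/

section HermitianDual

set_option linter.unusedSectionVars false

variable (K : Type*) [Field K] [Fintype K] {F : Type*} [Field F] [Algebra K F]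
variable {ι : Type*} [Fintype ι]

lemma card_eq_card_sq (hF : Module.finrank K F = 2) : Nat.card F = Fintype.card K ^ 2 := by
  have : Module.Finite K F := Module.finite_of_finrank_pos (by omega)
  rw [Module.natCard_eq_pow_finrank (K := K), hF, Nat.card_eq_fintype_card]

lemma pow_card_pow_card (hF : Module.finrank K F = 2) (x : F) :
    (x ^ Fintype.card K) ^ Fintype.card K = x := by
  have : Module.Finite K F := Module.finite_of_finrank_pos (by omega)
  have : Finite F := Module.finite_of_finite K
  have := Fintype.ofFinite F
  rw [← pow_mul, ← pow_two, ← card_eq_card_sq K hF, Nat.card_eq_fintype_card, FiniteField.pow_card]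

lemma hermInner_pow_card (hF : Module.finrank K F = 2) (u v : ι → F) :
    hermInner K u v ^ Fintype.card K = hermInner K v u := by
  simp only [hermInner, sum_pow_card, mul_pow, pow_card_pow_card K hF, mul_comm]

lemma hermInner_eq_zero_comm (hF : Module.finrank K F = 2) {u v : ι → F}
    (h : hermInner K u v = 0) : hermInner K v u = 0 := by
  rw [← hermInner_pow_card K hF, h, zero_pow Fintype.card_ne_zero]

lemma hermInner_add_right (u v w : ι → F) :
    hermInner K u (v + w) = hermInner K u v + hermInner K u w := by
  simp only [hermInner, Pi.add_apply, mul_add, Finset.sum_add_distrib]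

lemma hermInner_smul_right (r : F) (u v : ι → F) :
    hermInner K u (r • v) = r * hermInner K u v := by
  simp only [hermInner, Pi.smul_apply, smul_eq_mul, Finset.mul_sum, mul_left_comm]

/-- `x ↦ x ^ q` as an equivalence on words. -/
def powCardEquiv (hF : Module.finrank K F = 2) : (ι → F) ≃ (ι → F) where
  toFun u i := u i ^ Fintype.card K
  invFun u i := u i ^ Fintype.card K
  left_inv u := funext fun i => pow_card_pow_card K hF (u i)
  right_inv u := funext fun i => pow_card_pow_card K hF (u i)

/-- The coordinatewise `q`-th power maps the Hermitian dual bijectively onto the Euclidean dual `D`.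
It is only semilinear, so the dimensions are compared through cardinalities. -/
lemma finrank_add_finrank_hermDual (hF : Module.finrank K F = 2) (C : Submodule F (ι → F)) :
    Module.finrank F C + Module.finrank F (hermDual K C) = Fintype.card ι := by
  classical
  have : Module.Finite K F := Module.finite_of_finrank_pos (by omega)
  have : Finite F := Module.finite_of_finite K
  let D : Submodule F (ι → F) := C.dualAnnihilator.comap (dotProductEquiv F ι).toLinearMap
  have hD : Module.finrank F D = Module.finrank F C.dualAnnihilator := by
    have e : D = C.dualAnnihilator.map (dotProductEquiv F ι).symm.toLinearMap :=
      Submodule.comap_equiv_eq_map_symm _ _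
    rw [e, LinearEquiv.finrank_map_eq]
  have hcard : Nat.card (hermDual K C) = Nat.card D := by
    refine Nat.card_congr ((powCardEquiv K hF).subtypeEquiv fun u => ?_)
    simp only [D, Submodule.mem_comap, Submodule.mem_dualAnnihilator]
    rfl
  have hfin : Module.finrank F (hermDual K C) = Module.finrank F D := by
    rw [Module.natCard_eq_pow_finrank (K := F), Module.natCard_eq_pow_finrank (K := F) (V := D)]
      at hcard
    exact Nat.pow_right_injective Finite.one_lt_card hcard
  rw [hfin, hD, Subspace.finrank_add_finrank_dualAnnihilator_eq, Module.finrank_fintype_fun_eq_card]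

/-- Only nonemptiness is at stake: a self-dual code of positive length is nonzero, and otherwise `C`
is strictly smaller than its dual. -/
lemma exists_isLeast_distanceWords [DecidableEq F] [Nonempty ι] (hF : Module.finrank K F = 2)
    {C : Submodule F (ι → F)} (hC : C ≤ hermDual K C) :
    ∃ d, IsLeast (hammingNorm '' distanceWords K C) d := by
  have hne : (hammingNorm '' distanceWords K C).Nonempty := by
    refine Set.Nonempty.image _ ?_
    by_cases h : hermDual K C = C
    · have hpos : 0 < Module.finrank F C := by
        have h1 := finrank_add_finrank_hermDual K hF C
        rw [h] at h1
        have := Fintype.card_pos (α := ι)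
        omega
      obtain ⟨w, hw⟩ := (Submodule.nonzero_mem_of_bot_lt (bot_lt_iff_ne_bot.mpr
        (Submodule.one_le_finrank_iff.mp hpos)))
      exact ⟨w, by rw [h]; exact w.2, Or.inr ⟨h, fun h0 => hw (Subtype.ext h0)⟩⟩
    · obtain ⟨w, hw, hwC⟩ := SetLike.exists_of_lt (lt_of_le_of_ne hC (Ne.symm h))
      exact ⟨w, hw, Or.inl hwC⟩
  exact ⟨_, Nat.sInf_mem hne, fun _ h => Nat.sInf_le h⟩

end HermitianDual

/-! ### Dimension of the two-generator code -/

section TwoGen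

variable {F : Type*} [Field F] {m : ℕ}

/-- `(a, b) ↦ ([a g₁ + b v₂ g₂], [a v₁ g₁ + b g₂])`. -/
def twoGenMap (m : ℕ) (g₁ g₂ v₁ v₂ : F[X]) : F[X] × F[X] →ₗ[F] (Fin 2 × Fin m → F) :=
  LinearMap.pi fun ji => LinearMap.proj ji.2 ∘ₗ coeffVecLin F m ∘ₗ
    ((LinearMap.mulRight F (![g₁, v₁ * g₁] ji.1)).coprod
      (LinearMap.mulRight F (![v₂ * g₂, g₂] ji.1)))

lemma twoGenMap_apply (g₁ g₂ v₁ v₂ a b : F[X]) (ji : Fin 2 × Fin m) :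
    twoGenMap m g₁ g₂ v₁ v₂ (a, b) ji
      = coeffVec m (a * ![g₁, v₁ * g₁] ji.1 + b * ![v₂ * g₂, g₂] ji.1) ji.2 := by
  simp [twoGenMap, ← coeffVecLin_apply]

lemma twoGenMap_eq_zero_iff (hm : 0 < m) (g₁ g₂ v₁ v₂ a b : F[X]) :
    twoGenMap m g₁ g₂ v₁ v₂ (a, b) = 0 ↔
      X ^ m - 1 ∣ a * g₁ + b * (v₂ * g₂) ∧ X ^ m - 1 ∣ a * (v₁ * g₁) + b * g₂ := by
  rw [← coeffVec_eq_zero_iff hm, ← coeffVec_eq_zero_iff hm]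
  constructor
  · intro h
    constructor
    · ext i
      simpa [twoGenMap_apply] using congrFun h (0, i)
    · ext i
      simpa [twoGenMap_apply] using congrFun h (1, i)
  · rintro ⟨h0, h1⟩
    ext ⟨j, i⟩
    rw [twoGenMap_apply]
    fin_cases j
    · simpa using congrFun h0 i
    · simpa using congrFun h1 i

lemma range_twoGenMap (g₁ g₂ v₁ v₂ : F[X]) :
    LinearMap.range (twoGenMap m g₁ g₂ v₁ v₂) = twoGenCode m g₁ g₂ v₁ v₂ := by
  have h0 : ∀ r : F[X], (fun ji : Fin 2 × Fin m =>
      coeffVec m (r * ![![g₁, v₁ * g₁], ![v₂ * g₂, g₂]] 0 ji.1) ji.2)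
        = twoGenMap m g₁ g₂ v₁ v₂ (r, 0) := fun r => by
    ext ji
    simp [twoGenMap_apply]
  have h1 : ∀ r : F[X], (fun ji : Fin 2 × Fin m =>
      coeffVec m (r * ![![g₁, v₁ * g₁], ![v₂ * g₂, g₂]] 1 ji.1) ji.2)
        = twoGenMap m g₁ g₂ v₁ v₂ (0, r) := fun r => by
    ext ji
    simp [twoGenMap_apply]
  apply le_antisymm
  · rintro _ ⟨⟨a, b⟩, rfl⟩
    rw [show (a, b) = (a, 0) + (0, b) by simp, map_add, ← h0, ← h1]
    exact Submodule.add_mem _ (Submodule.subset_span ⟨a, 0, rfl⟩)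
      (Submodule.subset_span ⟨b, 1, rfl⟩)
  · rw [twoGenCode, qcCode, Submodule.span_le]
    rintro _ ⟨r, s, rfl⟩
    fin_cases s
    · exact ⟨(r, 0), (h0 r).symm⟩
    · exact ⟨(0, r), (h1 r).symm⟩

lemma parityPoly_monic (hm : 0 < m) {g : F[X]} (hg : g.Monic) (hd : g ∣ X ^ m - 1) :
    (parityPoly m g).Monic :=
  hg.of_mul_monic_left (mul_parityPoly hm hd ▸ monic_X_pow_sub_one hm)

lemma natDegree_add_natDegree_parityPoly (hm : 0 < m) {g : F[X]} (hg : g.Monic)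
    (hd : g ∣ X ^ m - 1) : g.natDegree + (parityPoly m g).natDegree = m := by
  rw [← hg.natDegree_mul (parityPoly_monic hm hg hd), mul_parityPoly hm hd]
  simpa using natDegree_X_pow_sub_C (n := m) (r := (1 : F))

lemma eq_zero_of_dvd_mul_of_mem_degreeLT (hm : 0 < m) {g a : F[X]} (hg : g.Monic)
    (hd : g ∣ X ^ m - 1) (ha : a ∈ degreeLT F (parityPoly m g).natDegree)
    (h : X ^ m - 1 ∣ a * g) : a = 0 := by
  rw [← mul_parityPoly hm hd, mul_comm a, mul_dvd_mul_iff_left hg.ne_zero] at h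
  refine eq_zero_of_dvd_of_degree_lt h ?_
  rw [degree_eq_natDegree (parityPoly_monic hm hg hd).ne_zero]
  exact mem_degreeLT.mp ha

/-- Pairs `(a, b)` with `deg a < deg h₁` and `deg b < deg h₂` parametrize the code bijectively. -/
lemma finrank_twoGenCode (hm : 0 < m) {g₁ g₂ v₁ v₂ : F[X]}
    (hg₁ : g₁.Monic) (hg₂ : g₂.Monic)
    (hd₁ : g₁ ∣ X ^ m - 1) (hd₂ : g₂ ∣ X ^ m - 1)
    (hv : IsCoprime (v₁ * v₂ - 1) (X ^ m - 1)) :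
    Module.finrank F (twoGenCode m g₁ g₂ v₁ v₂)
      = (parityPoly m g₁).natDegree + (parityPoly m g₂).natDegree := by
  set n₁ := (parityPoly m g₁).natDegree with hn₁
  set n₂ := (parityPoly m g₂).natDegree with hn₂
  let T : degreeLT F n₁ × degreeLT F n₂ →ₗ[F] (Fin 2 × Fin m → F) :=
    twoGenMap m g₁ g₂ v₁ v₂ ∘ₗ
      ((degreeLT F n₁).subtype.prodMap (degreeLT F n₂).subtype)
  have hT : ∀ a b, T (a, b) = twoGenMap m g₁ g₂ v₁ v₂ (a.1, b.1) := fun a b => rfl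
  have hinj : Function.Injective T := by
    rw [← LinearMap.ker_eq_bot, LinearMap.ker_eq_bot']
    rintro ⟨⟨a, ha⟩, ⟨b, hb⟩⟩ h
    rw [hT, twoGenMap_eq_zero_iff hm] at h
    obtain ⟨⟨r, hr⟩, ⟨s, hs⟩⟩ := h
    have hb' : b = 0 := by
      refine eq_zero_of_dvd_mul_of_mem_degreeLT hm hg₂ hd₂ hb (hv.symm.dvd_of_dvd_mul_left ?_)
      -- Eliminating `a` leaves `(v₁ v₂ - 1) b g₂`, whose first factor is prime to `X ^ m - 1`.
      exact ⟨v₁ * r - s, by linear_combination v₁ * hr - hs⟩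
    have ha' : a = 0 := by
      refine eq_zero_of_dvd_mul_of_mem_degreeLT hm hg₁ hd₁ ha (hv.symm.dvd_of_dvd_mul_left ?_)
      exact ⟨v₂ * s - r, by linear_combination v₂ * hs - hr⟩
    subst ha' hb'
    rfl
  have hrange : LinearMap.range T = twoGenCode m g₁ g₂ v₁ v₂ := by
    rw [← range_twoGenMap]
    apply le_antisymm
    · exact LinearMap.range_comp_le_range _ _
    · rintro _ ⟨⟨a, b⟩, rfl⟩
      have hM₁ := parityPoly_monic hm hg₁ hd₁
      have hM₂ := parityPoly_monic hm hg₂ hd₂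
      have mem : ∀ (c : F[X]) {h : F[X]}, h.Monic → c %ₘ h ∈ degreeLT F h.natDegree :=
        fun c h hh => by
          rw [mem_degreeLT, ← degree_eq_natDegree hh.ne_zero]
          exact degree_modByMonic_lt _ hh
      -- Reducing `a` modulo `h₁` and `b` modulo `h₂` preserves the word, as `g_i h_i = X ^ m - 1`.
      refine ⟨(⟨a %ₘ parityPoly m g₁, mem a hM₁⟩, ⟨b %ₘ parityPoly m g₂, mem b hM₂⟩), ?_⟩
      rw [hT, ← sub_eq_zero, ← map_sub, Prod.mk_sub_mk, twoGenMap_eq_zero_iff hm]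
      have e₁ := modByMonic_add_div a (parityPoly m g₁)
      have e₂ := modByMonic_add_div b (parityPoly m g₂)
      have p₁ := mul_parityPoly hm hd₁
      have p₂ := mul_parityPoly hm hd₂
      constructor
      · refine ⟨-(a /ₘ parityPoly m g₁) - v₂ * (b /ₘ parityPoly m g₂), ?_⟩
        linear_combination g₁ * e₁ - (a /ₘ parityPoly m g₁) * p₁ + v₂ * g₂ * e₂
          - v₂ * (b /ₘ parityPoly m g₂) * p₂
      · refine ⟨-(v₁ * (a /ₘ parityPoly m g₁)) - (b /ₘ parityPoly m g₂), ?_⟩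
        linear_combination v₁ * g₁ * e₁ - v₁ * (a /ₘ parityPoly m g₁) * p₁ + g₂ * e₂
          - (b /ₘ parityPoly m g₂) * p₂
  rw [← hrange, LinearMap.finrank_range_of_inj hinj, Module.finrank_prod,
    (degreeLTEquiv F n₁).finrank_eq, (degreeLTEquiv F n₂).finrank_eq, Module.finrank_fin_fun,
    Module.finrank_fin_fun]

end TwoGen

/-! ### Self-orthogonality of the code -/

section SelfOrthogonal

variable (K : Type*) [Field K] [Fintype K] {F : Type*} [Field F] [Algebra K F] {m : ℕ}

lemma coeffPow_mul (k l : F[X]) : coeffPow K (k * l) = coeffPow K k * coeffPow K l :=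
  Polynomial.map_mul _

/-- Two rows whose twisted product vanishes modulo `X ^ m - 1` generate orthogonal words. -/
lemma hermInner_row_eq_zero (hm : 0 < m) {l : ℕ} (k k' : Fin l → F[X])
    (h : X ^ m - 1 ∣ ∑ j, coeffPow K (k j) * (k' j).comp (X ^ (m - 1))) (r r' : F[X]) :
    hermInner K (fun ji : Fin l × Fin m => coeffVec m (r * k ji.1) ji.2)
      (fun ji => coeffVec m (r' * k' ji.1) ji.2) = 0 := by
  have h1 : hermInner K (fun ji : Fin l × Fin m => coeffVec m (r * k ji.1) ji.2)
      (fun ji => coeffVec m (r' * k' ji.1) ji.2)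
      = ∑ j, hermInner K (coeffVec m (r * k j)) (coeffVec m (r' * k' j)) := by
    simp only [hermInner]
    rw [Fintype.sum_prod_type]
  have h2 : ∑ j, coeffPow K (r * k j) * (r' * k' j).comp (X ^ (m - 1))
      = coeffPow K r * r'.comp (X ^ (m - 1))
        * ∑ j, coeffPow K (k j) * (k' j).comp (X ^ (m - 1)) := by
    rw [Finset.mul_sum]
    refine Finset.sum_congr rfl fun j _ => ?_
    rw [coeffPow_mul, mul_comp]
    ring
  rw [h1, Finset.sum_congr rfl fun j _ => hermInner_coeffVec K hm (r * k j) (r' * k' j),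
    ← Finset.sum_apply]
  simp only [← coeffVecLin_apply]
  rw [← map_sum, h2, coeffVecLin_apply, (coeffVec_eq_zero_iff hm _).mpr (h.mul_left _)]
  rfl

/-- The product is linear in its second argument only; conjugate symmetry swaps the arguments, so
that linearity can be used twice. -/
lemma span_le_hermDual_span {ι : Type*} [Fintype ι] {S : Set (ι → F)}
    (hF : Module.finrank K F = 2) (h : ∀ u ∈ S, ∀ v ∈ S, hermInner K u v = 0) :
    Submodule.span F S ≤ hermDual K (Submodule.span F S) := by
  have key : ∀ u : ι → F, (∀ v ∈ S, hermInner K u v = 0) →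
      ∀ v ∈ Submodule.span F S, hermInner K u v = 0 := fun u hu v hv => by
    induction hv using Submodule.span_induction with
    | mem v hv => exact hu v hv
    | zero => simp [hermInner]
    | add v w _ _ hv hw => rw [hermInner_add_right, hv, hw, add_zero]
    | smul r v _ hv => rw [hermInner_smul_right, hv, mul_zero]
  intro u hu
  exact key u fun v hv => hermInner_eq_zero_comm K hF
    (key v (fun w hw => h v hv w hw) u hu)

/-- The coefficients of `X ^ m - 1` are fixed by the `q`-th power, so `g^{[q]} h^{[q]} = X ^ m - 1`.
Passing from `a` to `b` allows the reduced `bar` to be replaced by plain substitution. -/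
lemma dvd_coeffPow_mul (hm : 0 < m) {g a b : F[X]} (hd : g ∣ X ^ m - 1)
    (h : coeffPow K (parityPoly m g) ∣ a) (hab : X ^ m - 1 ∣ a - b) :
    X ^ m - 1 ∣ coeffPow K g * b := by
  have h1 : X ^ m - 1 ∣ coeffPow K g * a := by
    have : coeffPow K g * coeffPow K (parityPoly m g) = X ^ m - 1 := by
      rw [← coeffPow_mul, mul_parityPoly hm hd]
      simp [coeffPow]
    exact this ▸ mul_dvd_mul_left _ h
  have h2 := dvd_sub h1 (hab.mul_left (coeffPow K g))
  rwa [← mul_sub, sub_sub_cancel] at h2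

theorem twoGenCode_le_hermDual (hF : Module.finrank K F = 2) (hm : 0 < m) {g₁ g₂ v₁ v₂ : F[X]}
    (hd₁ : g₁ ∣ X ^ m - 1) (hd₂ : g₂ ∣ X ^ m - 1)
    (h1 : coeffPow K (parityPoly m g₁) ∣ bar m g₁ * (1 + coeffPow K v₁ * bar m v₁))
    (h2 : coeffPow K (parityPoly m g₁) ∣ bar m g₂ * (bar m v₂ + coeffPow K v₁))
    (h3 : coeffPow K (parityPoly m g₂) ∣ bar m g₂ * (coeffPow K v₂ * bar m v₂ + 1)) :
    twoGenCode m g₁ g₂ v₁ v₂ ≤ hermDual K (twoGenCode m g₁ g₂ v₁ v₂) := by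
  obtain ⟨a₁, ha₁⟩ := dvd_bar_sub_comp (m := m) g₁
  obtain ⟨a₂, ha₂⟩ := dvd_bar_sub_comp (m := m) g₂
  obtain ⟨b₁, hb₁⟩ := dvd_bar_sub_comp (m := m) v₁
  obtain ⟨b₂, hb₂⟩ := dvd_bar_sub_comp (m := m) v₂
  rw [sub_eq_iff_eq_add] at ha₁ ha₂ hb₁ hb₂
  have o11 : X ^ m - 1 ∣ ∑ j, coeffPow K (![g₁, v₁ * g₁] j)
      * (![g₁, v₁ * g₁] j).comp (X ^ (m - 1)) := by
    have := dvd_coeffPow_mul K hm hd₁ h1 (b := g₁.comp (X ^ (m - 1))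
      * (1 + coeffPow K v₁ * v₁.comp (X ^ (m - 1))))
      (by rw [ha₁, hb₁]; exact ⟨a₁ * (1 + coeffPow K v₁ * ((X ^ m - 1) * b₁
            + v₁.comp (X ^ (m - 1)))) + g₁.comp (X ^ (m - 1)) * coeffPow K v₁ * b₁, by ring⟩)
    convert this using 1
    simp [coeffPow_mul]
    ring
  have o12 : X ^ m - 1 ∣ ∑ j, coeffPow K (![g₁, v₁ * g₁] j)
      * (![v₂ * g₂, g₂] j).comp (X ^ (m - 1)) := by
    have := dvd_coeffPow_mul K hm hd₁ h2 (b := g₂.comp (X ^ (m - 1))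
      * (v₂.comp (X ^ (m - 1)) + coeffPow K v₁))
      (by rw [ha₂, hb₂]; exact ⟨a₂ * ((X ^ m - 1) * b₂ + v₂.comp (X ^ (m - 1)) + coeffPow K v₁)
            + g₂.comp (X ^ (m - 1)) * b₂, by ring⟩)
    convert this using 1
    simp [coeffPow_mul]
    ring
  have o22 : X ^ m - 1 ∣ ∑ j, coeffPow K (![v₂ * g₂, g₂] j)
      * (![v₂ * g₂, g₂] j).comp (X ^ (m - 1)) := by
    have := dvd_coeffPow_mul K hm hd₂ h3 (b := g₂.comp (X ^ (m - 1))
      * (coeffPow K v₂ * v₂.comp (X ^ (m - 1)) + 1))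
      (by rw [ha₂, hb₂]; exact ⟨a₂ * (coeffPow K v₂ * ((X ^ m - 1) * b₂
            + v₂.comp (X ^ (m - 1))) + 1) + g₂.comp (X ^ (m - 1)) * coeffPow K v₂ * b₂, by ring⟩)
    convert this using 1
    simp [coeffPow_mul]
    ring
  refine span_le_hermDual_span K hF ?_
  rintro _ ⟨r, s, rfl⟩ _ ⟨r', s', rfl⟩
  fin_cases s <;> fin_cases s'
  · exact hermInner_row_eq_zero K hm _ _ o11 r r'
  · exact hermInner_row_eq_zero K hm _ _ o12 r r'
  -- The pair (second row, first row) needs no condition of its own: it is the conjugate of (2).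
  · exact hermInner_eq_zero_comm K hF (hermInner_row_eq_zero K hm _ _ o12 r' r)
  · exact hermInner_row_eq_zero K hm _ _ o22 r r'

end SelfOrthogonal

/-- Commuting endomorphisms of a nonzero finite-dimensional complex space have a common
eigenvector. -/
lemma exists_joint_eigenvector {V : Type*} [AddCommGroup V] [Module ℂ V] [FiniteDimensional ℂ V]
    [Nontrivial V] (S : Set (Module.End ℂ V)) (hS : ∀ A ∈ S, ∀ B ∈ S, A * B = B * A) :
    ∃ f : V, f ≠ 0 ∧ ∀ A ∈ S, ∃ s : ℂ, A f = s • f := by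
  -- Take a nonzero `S`-invariant subspace `W` of least dimension; every nonzero vector of it will
  -- serve.
  let P : ℕ → Prop := fun n => ∃ W : Submodule ℂ V, W ≠ ⊥ ∧ (∀ A ∈ S, ∀ v ∈ W, A v ∈ W) ∧
    Module.finrank ℂ W = n
  have hP : ∃ n, P n := ⟨_, ⊤, top_ne_bot, fun _ _ _ _ => trivial, rfl⟩
  classical
  obtain ⟨W, hW0, hWS, hWn⟩ := Nat.find_spec hP
  obtain ⟨f, hfW, hf0⟩ := Submodule.exists_mem_ne_zero_of_ne_bot hW0
  refine ⟨f, hf0, fun A hA => ?_⟩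
  have : Nontrivial W := Submodule.nontrivial_iff_ne_bot.mpr hW0
  obtain ⟨s, hs⟩ := Module.End.exists_eigenvalue (A.restrict (hWS A hA))
  obtain ⟨w, hw⟩ := hs.exists_hasEigenvector
  have hAw : A w = s • (w : V) := congrArg Subtype.val hw.apply_eq_smul
  -- By commutation this eigenspace inside `W` is again `S`-invariant, so minimality makes it all of
  -- `W`.
  let W' : Submodule ℂ V := W ⊓ Module.End.eigenspace A s
  have hW'0 : W' ≠ ⊥ := by
    intro h
    have : (w : V) ∈ W' := ⟨w.2, Module.End.mem_eigenspace_iff.mpr hAw⟩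
    rw [h, Submodule.mem_bot] at this
    exact hw.2 (Subtype.ext this)
  have hW'S : ∀ B ∈ S, ∀ v ∈ W', B v ∈ W' := by
    rintro B hB v ⟨hv, hv'⟩
    refine ⟨hWS B hB v hv, Module.End.mem_eigenspace_iff.mpr ?_⟩
    have := LinearMap.congr_fun (hS A hA B hB) v
    rw [Module.End.mul_apply, Module.End.mul_apply, Module.End.mem_eigenspace_iff.mp hv',
      map_smul] at this
    exact this
  have hle : Module.finrank ℂ W ≤ Module.finrank ℂ W' :=
    hWn.trans_le (Nat.find_min' hP ⟨W', hW'0, hW'S, rfl⟩)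
  have heq : W' = W := Submodule.eq_of_le_of_finrank_le inf_le_left hle
  have hfW' : f ∈ W' := heq ▸ hfW
  exact ⟨s, Module.End.mem_eigenspace_iff.mp hfW'.2⟩

/-! ### Commutation and traces of errors, and the averaging projector -/

section Stabilizer

set_option linter.unusedSectionVars false

variable (p : ℕ) [Fact p.Prime] {K : Type*} [Field K] [Fintype K] [Algebra (ZMod p) K]
variable {ι : Type*} [Fintype ι]

/-- The trace-symplectic form on labels of errors. -/
def symplForm (x y : (ι → K) × (ι → K)) : ZMod p := trDot p x.2 y.1 - trDot p y.2 x.1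

/-- The error `X(a) Z(b)`. -/
abbrev pauli (x : (ι → K) × (ι → K)) : ((ι → K) → ℂ) ≃ₗ[ℂ] ((ι → K) → ℂ) :=
  errorOp p 0 x.1 x.2

lemma phase_ne_zero (c : ZMod p) : phase p c ≠ 0 := by
  intro h
  have := phase_add p c (-c)
  rw [add_neg_cancel, phase_zero, h, zero_mul] at this
  exact one_ne_zero this

lemma phase_eq_one_iff (c : ZMod p) : phase p c = 1 ↔ c = 0 := by
  constructor
  · intro h
    exact ZMod.injective_stdAddChar (h.trans (phase_zero p).symm)
  · rintro rfl
    exact phase_zero p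

lemma star_phase_mul_phase (c : ZMod p) : star (phase p c) * phase p c = 1 := by
  have h : ‖phase p c‖ = 1 := by
    rw [phase]
    exact AddChar.norm_apply _ _
  rw [Complex.star_def, ← Complex.normSq_eq_conj_mul_self, Complex.normSq_eq_norm_sq, h]
  norm_num

lemma errorOp_eq_smul_pauli (c : ZMod p) (a b : ι → K) (f : (ι → K) → ℂ) :
    errorOp p c a b f = phase p c • pauli p (a, b) f := by
  ext x
  simp [errorOp_apply, phase_add, mul_assoc]

lemma pauli_pauli (x y : (ι → K) × (ι → K)) (f : (ι → K) → ℂ) :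
    pauli p x (pauli p y f) = phase p (trDot p x.2 y.1) • pauli p (x + y) f := by
  rw [← LinearEquiv.mul_apply, errorOp_mul, errorOp_eq_smul_pauli, zero_add, zero_add]
  rfl

lemma pauli_comm (x y : (ι → K) × (ι → K)) (f : (ι → K) → ℂ) :
    pauli p x (pauli p y f) = phase p (symplForm p x y) • pauli p y (pauli p x f) := by
  rw [pauli_pauli, pauli_pauli, smul_smul, ← phase_add, symplForm, add_comm y x, sub_add_cancel]

lemma star_dotProduct_errorOp (c : ZMod p) (a b : ι → K) (u v : (ι → K) → ℂ) [DecidableEq ι] :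
    star (errorOp p c a b u) ⬝ᵥ errorOp p c a b v = star u ⬝ᵥ v := by
  simp only [dotProduct, Pi.star_apply, errorOp_apply, star_mul']
  rw [← Equiv.sum_comp (Equiv.addRight a)]
  refine Finset.sum_congr rfl fun x _ => ?_
  rw [mul_mul_mul_comm, star_phase_mul_phase, one_mul, Equiv.coe_addRight, add_sub_cancel_right]

lemma exists_trDot_ne_zero {b : ι → K} (hb : b ≠ 0) : ∃ x, trDot p b x ≠ 0 := by
  classical
  obtain ⟨i, hi⟩ := Function.ne_iff.mp hb
  obtain ⟨z, hz⟩ := Algebra.trace_surjective (ZMod p) K 1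
  refine ⟨Pi.single i ((b i)⁻¹ * z), ?_⟩
  have : ∑ j, b j * (Pi.single i ((b i)⁻¹ * z) : ι → K) j = z := by
    rw [Finset.sum_eq_single i]
    · rw [Pi.single_eq_same, mul_inv_cancel_left₀ hi]
    · intro j _ hj
      rw [Pi.single_eq_of_ne hj, mul_zero]
    · simp
  rw [trDot, this, hz]
  exact one_ne_zero

lemma trace_pauli_zero [DecidableEq ι] :
    LinearMap.trace ℂ _ (pauli p (0 : (ι → K) × (ι → K))).toLinearMap
      = Fintype.card K ^ Fintype.card ι := by
  have : (pauli p (0 : (ι → K) × (ι → K))) = 1 := errorOp_one p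
  rw [this]
  have h1 : ((1 : ((ι → K) → ℂ) ≃ₗ[ℂ] ((ι → K) → ℂ)) : ((ι → K) → ℂ) →ₗ[ℂ] ((ι → K) → ℂ)) = 1 :=
    rfl
  classical
  rw [h1, LinearMap.trace_one, Module.finrank_fintype_fun_eq_card, Fintype.card_fun]
  push_cast
  rfl

/-- A nonzero shift `a` leaves no diagonal entries. For `a = 0` the diagonal is a nontrivial
additive character, with sum zero. -/
lemma trace_pauli_of_ne_zero [DecidableEq ι] {x : (ι → K) × (ι → K)} (hx : x ≠ 0) :
    LinearMap.trace ℂ _ (pauli p x).toLinearMap = 0 := by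
  classical
  rw [LinearMap.trace_eq_matrix_trace ℂ (Pi.basisFun ℂ (ι → K)), Matrix.trace]
  have hdiag : ∀ y : ι → K, (LinearMap.toMatrix (Pi.basisFun ℂ (ι → K)) (Pi.basisFun ℂ (ι → K))
      (pauli p x).toLinearMap).diag y
      = phase p (trDot p x.2 (y - x.1)) * (Pi.single y (1 : ℂ) : (ι → K) → ℂ) (y - x.1) := by
    intro y
    simp [Matrix.diag, errorOp_apply]
  rw [Finset.sum_congr rfl fun y _ => hdiag y]
  by_cases ha : x.1 = 0
  · have hb : x.2 ≠ 0 := fun h => hx (Prod.ext ha h)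
    let ψ : AddChar (ι → K) ℂ :=
      { toFun := fun y => phase p (trDot p x.2 y)
        map_zero_eq_one' := by simp [trDot, phase_zero]
        map_add_eq_mul' := fun y z => by rw [trDot_add, phase_add] }
    have hψ : ψ ≠ 0 := by
      obtain ⟨y, hy⟩ := exists_trDot_ne_zero p hb
      intro h
      have := DFunLike.congr_fun h y
      exact hy ((phase_eq_one_iff p _).mp this)
    rw [← AddChar.sum_eq_zero_iff_ne_zero.mpr hψ]
    refine Finset.sum_congr rfl fun y _ => ?_
    rw [ha, sub_zero, Pi.single_eq_same, mul_one]
    rfl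
  · refine Finset.sum_eq_zero fun y _ => ?_
    rw [Pi.single_eq_of_ne (by simpa using ha), mul_zero]

/-- The joint eigenspace of the errors labelled by `D` with eigenvalues `χ`. -/
def stabSpace (D : AddSubgroup ((ι → K) × (ι → K))) (χ : (ι → K) × (ι → K) → ℂ) :
    Submodule ℂ ((ι → K) → ℂ) where
  carrier := {v | ∀ d ∈ D, pauli p d v = χ d • v}
  add_mem' hu hv d hd := by rw [map_add, hu d hd, hv d hd, smul_add]
  zero_mem' d _ := by rw [map_zero, smul_zero]
  smul_mem' r v hv d hd := by rw [map_smul, hv d hd, smul_comm]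

variable {p} {D : AddSubgroup ((ι → K) × (ι → K))} {χ : (ι → K) × (ι → K) → ℂ}
  {f : (ι → K) → ℂ}

lemma eigenvalue_ne_zero (hf0 : f ≠ 0) (hf : f ∈ stabSpace p D χ) {d : (ι → K) × (ι → K)}
    (hd : d ∈ D) : χ d ≠ 0 := by
  intro h
  have := hf d hd
  rw [h, zero_smul] at this
  exact hf0 ((LinearEquiv.map_eq_zero_iff _).mp this)

/-- The eigenvalues obey the same phase cocycle as the errors, so dividing each error by its
eigenvalue gives a genuine representation of `D`. -/
lemma eigenvalue_mul (hf0 : f ≠ 0) (hf : f ∈ stabSpace p D χ) {d e : (ι → K) × (ι → K)}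
    (hd : d ∈ D) (he : e ∈ D) : χ d * χ e = phase p (trDot p d.2 e.1) * χ (d + e) := by
  have h := pauli_pauli p d e f
  rw [hf e he, map_smul, hf d hd, hf _ (D.add_mem hd he), smul_smul, smul_smul] at h
  rw [mul_comm]
  exact smul_left_injective ℂ hf0 h

/-- The errors labelled by `D`, normalized to fix the eigenvector, represent `D`. -/
def stabRep (hf0 : f ≠ 0) (hf : f ∈ stabSpace p D χ) :
    Representation ℂ (Multiplicative D) ((ι → K) → ℂ) where
  toFun d := (χ d.toAdd)⁻¹ • (pauli p (d.toAdd : (ι → K) × (ι → K))).toLinearMap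
  map_one' := by
    have h0 : χ 0 = 1 := by
      have := eigenvalue_mul hf0 hf D.zero_mem D.zero_mem
      have h := eigenvalue_ne_zero hf0 hf D.zero_mem
      rw [Prod.snd_zero, zero_trDot, phase_zero, one_mul, add_zero] at this
      exact mul_right_cancel₀ h (this.trans (one_mul _).symm)
    have h1 : pauli p (0 : (ι → K) × (ι → K)) = 1 := errorOp_one p
    simp only [toAdd_one, ZeroMemClass.coe_zero, h0, h1, inv_one, one_smul]
    rfl
  map_mul' d e := by
    have hχ := eigenvalue_mul hf0 hf d.toAdd.2 e.toAdd.2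
    have hd := eigenvalue_ne_zero hf0 hf d.toAdd.2
    have he := eigenvalue_ne_zero hf0 hf e.toAdd.2
    have hde := eigenvalue_ne_zero hf0 hf (D.add_mem d.toAdd.2 e.toAdd.2)
    ext1 v
    simp only [LinearMap.smul_apply, Module.End.mul_apply, LinearEquiv.coe_coe, map_smul,
      toAdd_mul, AddSubgroup.coe_add]
    rw [pauli_pauli, smul_smul, smul_smul]
    congr 1
    have hph := phase_ne_zero p (trDot p (d.toAdd : (ι → K) × (ι → K)).2
      (e.toAdd : (ι → K) × (ι → K)).1)
    field_simp
    linear_combination hχ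

lemma stabRep_apply (hf0 : f ≠ 0) (hf : f ∈ stabSpace p D χ) (d : Multiplicative D) :
    stabRep hf0 hf d = (χ d.toAdd)⁻¹ • (pauli p (d.toAdd : (ι → K) × (ι → K))).toLinearMap := rfl

/-- Hence averaging over `D` projects onto the code. -/
lemma invariants_stabRep (hf0 : f ≠ 0) (hf : f ∈ stabSpace p D χ) :
    (stabRep hf0 hf).invariants = stabSpace p D χ := by
  ext v
  rw [Representation.mem_invariants]
  have key : ∀ d (hd : d ∈ D), (χ d)⁻¹ • pauli p d v = v ↔ pauli p d v = χ d • v := fun d hd =>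
    inv_smul_eq_iff₀ (eigenvalue_ne_zero hf0 hf hd)
  constructor
  · intro h d hd
    exact (key d hd).mp (h (Multiplicative.ofAdd ⟨d, hd⟩))
  · intro h d
    exact (key _ d.toAdd.2).mpr (h _ d.toAdd.2)

/-- Only a term with `x + d = 0` can survive: `x = 0` will give the dimension of the code, and `x ∉
D` gives trace zero. -/
lemma trace_pauli_mul_averageMap [DecidableEq ι] [Fintype (Multiplicative D)]
    [Invertible (Fintype.card (Multiplicative D) : ℂ)]
    (hf0 : f ≠ 0) (hf : f ∈ stabSpace p D χ) (x : (ι → K) × (ι → K)) :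
    LinearMap.trace ℂ _ ((pauli p x).toLinearMap * (stabRep hf0 hf).averageMap)
      = ⅟(Fintype.card (Multiplicative D) : ℂ) * ∑ d : Multiplicative D,
        (χ d.toAdd)⁻¹ * (phase p (trDot p x.2 (d.toAdd : (ι → K) × (ι → K)).1) *
          LinearMap.trace ℂ _ (pauli p (x + (d.toAdd : (ι → K) × (ι → K)))).toLinearMap) := by
  have h : (pauli p x).toLinearMap * (stabRep hf0 hf).averageMap
      = ⅟(Fintype.card (Multiplicative D) : ℂ) • ∑ d : Multiplicative D,
        (χ d.toAdd)⁻¹ • phase p (trDot p x.2 (d.toAdd : (ι → K) × (ι → K)).1) •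
          (pauli p (x + (d.toAdd : (ι → K) × (ι → K)))).toLinearMap := by
    rw [Representation.averageMap, GroupAlgebra.average, map_smul, map_sum, mul_smul_comm,
      Finset.mul_sum]
    congr 1
    refine Finset.sum_congr rfl fun d _ => ?_
    rw [MonoidAlgebra.of_apply, Representation.asAlgebraHom_single_one, stabRep_apply,
      mul_smul_comm]
    congr 1
    ext1 v
    exact pauli_pauli p x d.toAdd v
  rw [h, map_smul, map_sum, smul_eq_mul]
  congr 1
  refine Finset.sum_congr rfl fun d _ => ?_
  rw [map_smul, map_smul, smul_eq_mul, smul_eq_mul]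

end Stabilizer

open scoped ComplexOrder in
lemma eq_zero_of_star_dotProduct_self {n : Type*} [Fintype n] {f : n → ℂ}
    (h : star f ⬝ᵥ f = 0) : f = 0 :=
  dotProduct_star_self_eq_zero.mp h

/-! ### Stabilizer codes from isotropic groups of labels -/

section Stabilizer

set_option linter.unusedSectionVars false

variable {p : ℕ} [Fact p.Prime] {K : Type*} [Field K] [Fintype K] [Algebra (ZMod p) K]
variable {ι : Type*} [Fintype ι] [DecidableEq ι]
variable {D : AddSubgroup ((ι → K) × (ι → K))} {χ : (ι → K) × (ι → K) → ℂ}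
  {f : (ι → K) → ℂ}

lemma exists_mem_stabSpace (hD : ∀ x ∈ D, ∀ y ∈ D, symplForm p x y = 0) :
    ∃ (χ : (ι → K) × (ι → K) → ℂ) (f : (ι → K) → ℂ), f ≠ 0 ∧ f ∈ stabSpace p D χ := by
  obtain ⟨f, hf0, hf⟩ := exists_joint_eigenvector
    {A : Module.End ℂ ((ι → K) → ℂ) | ∃ d ∈ D, A = (pauli p d).toLinearMap} (by
      rintro _ ⟨d, hd, rfl⟩ _ ⟨e, he, rfl⟩
      ext1 v
      have := pauli_comm p d e v
      rwa [hD d hd e he, phase_zero, one_smul] at this)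
  choose! s hs using hf
  exact ⟨fun d => s (pauli p d).toLinearMap, f, hf0, fun d hd => hs _ ⟨d, hd, rfl⟩⟩

lemma isStabilizerCode_stabSpace (hD : ∀ x ∈ D, ∀ y ∈ D, symplForm p x y = 0)
    (hf0 : f ≠ 0) (hf : f ∈ stabSpace p D χ) : IsStabilizerCode p (stabSpace p D χ) := by
  refine ⟨fun h => hf0 (by rwa [h, Submodule.mem_bot] at hf), ?_⟩
  let S : Subgroup (((ι → K) → ℂ) ≃ₗ[ℂ] ((ι → K) → ℂ)) :=
    { carrier := {E | ∃ (c : ZMod p) (x : (ι → K) × (ι → K)), x ∈ D ∧ E = errorOp p c x.1 x.2}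
      mul_mem' := by
        rintro _ _ ⟨c, x, hx, rfl⟩ ⟨c', y, hy, rfl⟩
        exact ⟨_, x + y, D.add_mem hx hy, errorOp_mul p c c' _ _ _ _⟩
      one_mem' := ⟨0, 0, D.zero_mem, (errorOp_one p).symm⟩
      inv_mem' := by
        rintro _ ⟨c, x, hx, rfl⟩
        refine ⟨-c + trDot p x.2 x.1, -x, D.neg_mem hx, inv_eq_of_mul_eq_one_right ?_⟩
        rw [errorOp_mul, Prod.fst_neg, Prod.snd_neg, trDot_neg, add_neg_cancel, add_neg_cancel,
          ← errorOp_one p]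
        congr 1
        ring }
  have happ : ∀ (c : ZMod p) (x : (ι → K) × (ι → K)) (v : (ι → K) → ℂ),
      errorOp p c x.1 x.2 v = phase p c • pauli p x v := fun c x v =>
    errorOp_eq_smul_pauli p c x.1 x.2 v
  refine ⟨S, ?_, ?_, ?_⟩
  · rintro _ ⟨c, x, -, rfl⟩
    exact ⟨c, x.1, x.2, rfl⟩
  · rintro _ ⟨c, x, hx, rfl⟩ _ ⟨c', y, hy, rfl⟩
    have h := hD x hx y hy
    rw [symplForm, sub_eq_zero] at h
    rw [errorOp_mul, errorOp_mul, h, add_comm c, add_comm x.1, add_comm x.2]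
  · have hs : ∀ E ∈ S, ∃ s : ℂ, E f = s • f := by
      rintro _ ⟨c, x, hx, rfl⟩
      exact ⟨phase p c * χ x, by rw [happ, hf x hx, smul_smul]⟩
    -- The eigenvalue must be a function of the operator, not of its label; it is read off from the
    -- fixed vector `f`.
    choose! s hs using hs
    have hsx : ∀ c x, x ∈ D → s (errorOp p c x.1 x.2) = phase p c * χ x := fun c x hx => by
      have h := hs _ ⟨c, x, hx, rfl⟩
      rw [happ, hf x hx, smul_smul] at h
      exact (smul_left_injective ℂ hf0 h).symm
    refine ⟨s, fun v => ⟨?_, fun h d hd => ?_⟩⟩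
    · rintro hv _ ⟨c, x, hx, rfl⟩
      rw [hsx c x hx, happ, hv x hx, smul_smul]
    · have := h _ ⟨0, d, hd, rfl⟩
      rwa [hsx 0 d hd, phase_zero, one_mul] at this

lemma finrank_stabSpace_mul_card (hf0 : f ≠ 0) (hf : f ∈ stabSpace p D χ) :
    Module.finrank ℂ (stabSpace p D χ) * Nat.card D = Fintype.card K ^ Fintype.card ι := by
  have := Fintype.ofFinite (Multiplicative D)
  have hne : (Fintype.card (Multiplicative D) : ℂ) ≠ 0 := Nat.cast_ne_zero.mpr Fintype.card_ne_zero
  let inv := invertibleOfNonzero hne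
  have htr := (stabRep hf0 hf).isProj_averageMap.trace
  rw [invariants_stabRep hf0 hf] at htr
  have h0 := trace_pauli_mul_averageMap hf0 hf 0
  have h1 : (pauli p (0 : (ι → K) × (ι → K))).toLinearMap
      = (1 : ((ι → K) → ℂ) →ₗ[ℂ] ((ι → K) → ℂ)) :=
    congrArg LinearEquiv.toLinearMap (errorOp_one (K := K) (ι := ι) p)
  rw [h1, one_mul, htr, Finset.sum_eq_single 1] at h0
  · have hχ : χ 0 = 1 := by
      have := hf 0 D.zero_mem
      rw [show pauli p (0 : (ι → K) × (ι → K)) = 1 from errorOp_one p] at this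
      exact smul_left_injective ℂ hf0 (this.symm.trans (one_smul ℂ f).symm)
    rw [toAdd_one, ZeroMemClass.coe_zero, hχ, add_zero, trace_pauli_zero, Prod.snd_zero,
      zero_trDot, phase_zero, inv_one, one_mul, one_mul, invOf_eq_inv] at h0
    have h2 : (Module.finrank ℂ (stabSpace p D χ) : ℂ) * (Fintype.card (Multiplicative D) : ℂ)
        = (Fintype.card K : ℂ) ^ Fintype.card ι := by
      rw [h0]
      field_simp
    rw [← Nat.card_congr (Multiplicative.ofAdd (α := D)).symm, Nat.card_eq_fintype_card]
    exact_mod_cast h2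
  · intro d _ hd
    rw [zero_add, trace_pauli_of_ne_zero, mul_zero, mul_zero]
    intro h
    exact hd (Subtype.ext h)
  · simp

/-- Apply the unitary error `d` to both arguments: as `|χ d| = 1`, the product equals itself times a
phase different from `1`. -/
lemma star_dotProduct_eq_zero_of_symplForm_ne_zero (hf0 : f ≠ 0) (hf : f ∈ stabSpace p D χ)
    {x d : (ι → K) × (ι → K)} (hd : d ∈ D) (hx : symplForm p d x ≠ 0) (c : ZMod p)
    {u v : (ι → K) → ℂ} (hu : u ∈ stabSpace p D χ) (hv : v ∈ stabSpace p D χ) :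
    star u ⬝ᵥ errorOp p c x.1 x.2 v = 0 := by
  have hχ : star (χ d) * χ d = 1 := by
    have h := star_dotProduct_errorOp p 0 d.1 d.2 f f
    rw [hf d hd, star_smul, smul_dotProduct, dotProduct_smul, smul_smul] at h
    have hff : star f ⬝ᵥ f ≠ 0 := fun h0 => hf0 (eq_zero_of_star_dotProduct_self h0)
    exact mul_right_cancel₀ hff (h.trans (one_mul _).symm)
  have h := star_dotProduct_errorOp p 0 d.1 d.2 u (pauli p x v)
  rw [hu d hd, pauli_comm, hv d hd, map_smul, star_smul, smul_dotProduct, dotProduct_smul,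
    dotProduct_smul, smul_eq_mul, smul_eq_mul, smul_eq_mul] at h
  have h' : (phase p (symplForm p d x) - 1) * (star u ⬝ᵥ pauli p x v) = 0 := by
    linear_combination h - phase p (symplForm p d x) * (star u ⬝ᵥ pauli p x v) * hχ
  have h'' := (mul_eq_zero.mp h').resolve_left
    (sub_ne_zero.mpr fun h1 => hx ((phase_eq_one_iff p _).mp h1))
  rw [errorOp_eq_smul_pauli, dotProduct_smul]
  exact (congrArg _ h'').trans (smul_zero _)

lemma errorOp_eq_smul_of_mem {v : (ι → K) → ℂ} (hv : v ∈ stabSpace p D χ)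
    {x : (ι → K) × (ι → K)} (hx : x ∈ D) (c : ZMod p) :
    errorOp p c x.1 x.2 v = (phase p c * χ x) • v := by
  rw [mul_smul, ← hv x hx]
  exact errorOp_eq_smul_pauli p c x.1 x.2 v

/-- The error commutes with `D`, so it preserves the code; if detected, it would act there as a
nonzero scalar and have nonzero trace on the code. For `x ∉ D` that trace is zero. -/
lemma not_detects_of_mem_dual (hf0 : f ≠ 0) (hf : f ∈ stabSpace p D χ)
    {x : (ι → K) × (ι → K)} (hx : x ∉ D) (hxD : ∀ d ∈ D, symplForm p d x = 0) (c : ZMod p) :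
    ¬ Detects (stabSpace p D χ) (errorOp p c x.1 x.2) := by
  rintro ⟨s, hs⟩
  have hE : ∀ v, errorOp p c x.1 x.2 v = phase p c • pauli p x v :=
    fun v => errorOp_eq_smul_pauli p c x.1 x.2 v
  have hmem : ∀ v ∈ stabSpace p D χ, errorOp p c x.1 x.2 v ∈ stabSpace p D χ := by
    intro v hv d hd
    rw [hE, map_smul, pauli_comm, hxD d hd, phase_zero, one_smul, hv d hd, map_smul, smul_comm]
  have hscal : ∀ v ∈ stabSpace p D χ, errorOp p c x.1 x.2 v = s • v := by
    intro v hv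
    have hw : errorOp p c x.1 x.2 v - s • v ∈ stabSpace p D χ :=
      Submodule.sub_mem _ (hmem v hv) (Submodule.smul_mem _ _ hv)
    -- The difference lies in the code, so detection applies with it as left argument and makes it
    -- orthogonal to itself.
    have h0 : star (errorOp p c x.1 x.2 v - s • v) ⬝ᵥ (errorOp p c x.1 x.2 v - s • v) = 0 := by
      rw [dotProduct_sub, hs _ hw v hv, dotProduct_smul, smul_eq_mul, sub_self]
    exact sub_eq_zero.mp (eq_zero_of_star_dotProduct_self h0)
  have hs0 : s ≠ 0 := by
    intro h
    have := hscal f hf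
    rw [h, zero_smul] at this
    exact hf0 ((LinearEquiv.map_eq_zero_iff _).mp this)
  have := Fintype.ofFinite (Multiplicative D)
  have hne : (Fintype.card (Multiplicative D) : ℂ) ≠ 0 := Nat.cast_ne_zero.mpr Fintype.card_ne_zero
  let inv := invertibleOfNonzero hne
  have hproj := (stabRep hf0 hf).isProj_averageMap
  rw [invariants_stabRep hf0 hf] at hproj
  have h1 : phase p c • ((pauli p x).toLinearMap * (stabRep hf0 hf).averageMap)
      = s • (stabRep hf0 hf).averageMap := by
    ext1 v
    exact (hE _).symm.trans (hscal _ (hproj.map_mem v))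
  have h2 := congrArg (LinearMap.trace ℂ _) h1
  rw [map_smul, map_smul, hproj.trace, trace_pauli_mul_averageMap, Finset.sum_eq_zero, mul_zero,
    smul_zero, eq_comm, smul_eq_mul] at h2
  · have hpos : Module.finrank ℂ (stabSpace p D χ) ≠ 0 := by
      intro h
      have := finrank_stabSpace_mul_card hf0 hf
      rw [h, zero_mul] at this
      exact pow_ne_zero _ Fintype.card_ne_zero this.symm
    exact mul_ne_zero hs0 (Nat.cast_ne_zero.mpr hpos) h2
  · intro d _
    rw [trace_pauli_of_ne_zero, mul_zero, mul_zero]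
    intro h
    exact hx (eq_neg_of_add_eq_zero_left h ▸ D.neg_mem d.toAdd.2)

/-- An isotropic group of error labels yields a stabilizer code, whose distance is the least
weight in the symplectic dual outside the group. -/
theorem exists_isStabilizerCodeWithParams (D : AddSubgroup ((ι → K) × (ι → K)))
    (hD : ∀ x ∈ D, ∀ y ∈ D, symplForm p x y = 0) {n k d : ℕ} (hn : Fintype.card ι = n)
    (hk : Fintype.card K ^ k * Nat.card D = Fintype.card K ^ n)
    (hd : k ≠ 0 → IsLeast {w | ∃ x : (ι → K) × (ι → K), errorWeight x.1 x.2 = w ∧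
      (∀ e ∈ D, symplForm p e x = 0) ∧ x ∉ D} d)
    (hd0 : k = 0 → IsLeast {w | ∃ x : (ι → K) × (ι → K), errorWeight x.1 x.2 = w ∧
      (∀ e ∈ D, symplForm p e x = 0) ∧ x ≠ 0} d)
    (hself : k = 0 → ∀ x, (∀ e ∈ D, symplForm p e x = 0) → x ∈ D) :
    ∃ Q : Submodule ℂ ((ι → K) → ℂ), IsStabilizerCodeWithParams p n k d Q := by
  obtain ⟨χ, f, hf0, hf⟩ := exists_mem_stabSpace hD
  refine ⟨stabSpace p D χ, hn, isStabilizerCode_stabSpace hD hf0 hf, ?_, fun h => ?_, fun h => ?_⟩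
  · have := finrank_stabSpace_mul_card hf0 hf
    rw [hn, ← hk] at this
    exact Nat.eq_of_mul_eq_mul_right Nat.card_pos this
  · convert hd h using 1
    ext w
    constructor
    · rintro ⟨c, a, b, hw, hdet⟩
      refine ⟨(a, b), hw, ?_, ?_⟩
      · by_contra! hcon
        obtain ⟨e, he, hne⟩ := hcon
        refine hdet ⟨0, fun u hu v hv => ?_⟩
        rw [zero_mul]
        exact star_dotProduct_eq_zero_of_symplForm_ne_zero hf0 hf he hne c hu hv
      · intro hmem
        refine hdet ⟨phase p c * χ (a, b), fun u _ v hv => ?_⟩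
        rw [errorOp_eq_smul_of_mem hv hmem c, dotProduct_smul, smul_eq_mul]
    · rintro ⟨x, hw, hxD, hx⟩
      exact ⟨0, x.1, x.2, hw, not_detects_of_mem_dual hf0 hf hx hxD 0⟩
  · convert hd0 h using 1
    have hwt : ∀ x : (ι → K) × (ι → K), errorWeight x.1 x.2 ≠ 0 ↔ x ≠ 0 := by
      intro x
      rw [not_iff_not, errorWeight, Finite.card_eq_zero_iff, isEmpty_subtype]
      simp only [ne_eq, not_not, Prod.mk.injEq]
      exact ⟨fun h => Prod.ext (funext fun i => (h i).1) (funext fun i => (h i).2),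
        fun h i => by simp [h]⟩
    ext w
    constructor
    · rintro ⟨c, a, b, hw, hw0, u, hu, v, hv, huv⟩
      refine ⟨(a, b), hw, ?_, (hwt (a, b)).mp (hw ▸ hw0)⟩
      by_contra! hcon
      obtain ⟨e, he, hne⟩ := hcon
      exact huv (star_dotProduct_eq_zero_of_symplForm_ne_zero hf0 hf he hne c hu hv)
    · rintro ⟨x, hw, hxD, hx⟩
      refine ⟨0, x.1, x.2, hw, hw ▸ (hwt x).mpr hx, f, hf, f, hf, ?_⟩
      -- For `k = 0` the group is its own dual, so the error acts on `f` as a nonzero scalar.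
      have hxD' := hself h x hxD
      rw [errorOp_eq_smul_of_mem hf hxD', dotProduct_smul, smul_eq_mul]
      refine mul_ne_zero (mul_ne_zero (phase_ne_zero p 0) (eigenvalue_ne_zero hf0 hf hxD')) ?_
      intro h0
      exact hf0 (eq_zero_of_star_dotProduct_self h0)

end Stabilizer

/-! ### From Hermitian to trace-symplectic duality -/

section HermitianStabilizer

set_option linter.unusedSectionVars false

variable {K : Type*} [Field K] [Fintype K] {F : Type*} [Field F] [Algebra K F]
variable {ι : Type*} [Fintype ι]

variable (K) in
-- Otherwise the `q`-Frobenius of `F` over `K` would be trivial, but its order is `[F : K] = 2`.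
lemma exists_pow_card_ne (hF : Module.finrank K F = 2) :
    ∃ γ : F, γ ^ Fintype.card K ≠ γ := by
  have : Module.Finite K F := Module.finite_of_finrank_pos (by omega)
  have : Finite F := Module.finite_of_finite K
  by_contra! h
  have h1 : FiniteField.frobeniusAlgHom K F = 1 := AlgHom.ext fun x => h x
  have := FiniteField.orderOf_frobeniusAlgHom K F
  rw [h1, orderOf_one, hF] at this
  omega

lemma algebraMap_pow_card (a : K) :
    algebraMap K F a ^ Fintype.card K = algebraMap K F a := by
  rw [← map_pow, FiniteField.pow_card]

/-- The word over `F` with coordinates `a i + γ * b i`. -/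
def pairWord (γ : F) : ((ι → K) × (ι → K)) →+ (ι → F) where
  toFun x i := algebraMap K F (x.1 i) + γ * algebraMap K F (x.2 i)
  map_zero' := by
    ext
    simp
  map_add' x y := by
    ext i
    simp only [Prod.fst_add, Prod.snd_add, Pi.add_apply, map_add]
    ring

lemma pairWord_apply (γ : F) (x : (ι → K) × (ι → K)) (i : ι) :
    pairWord γ x i = algebraMap K F (x.1 i) + γ * algebraMap K F (x.2 i) := rfl

variable {γ : F}

/-- The `q`-th power fixes `K`, so `γ ∉ K`, and `1, γ` are independent over `K`. -/
lemma add_mul_eq_zero_iff (hγ : γ ^ Fintype.card K ≠ γ) (a b : K) :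
    algebraMap K F a + γ * algebraMap K F b = 0 ↔ a = 0 ∧ b = 0 := by
  constructor
  · intro h
    have hb : b = 0 := by
      by_contra hb
      have hb' : algebraMap K F b ≠ 0 := (_root_.map_ne_zero _).mpr hb
      have hγ' : γ = algebraMap K F (-a / b) := by
        rw [map_div₀, map_neg, eq_div_iff hb']
        linear_combination h
      exact hγ (hγ' ▸ algebraMap_pow_card _)
    subst hb
    simpa using h
  · rintro ⟨rfl, rfl⟩
    simp

lemma pairWord_bijective (hF : Module.finrank K F = 2) (hγ : γ ^ Fintype.card K ≠ γ) :
    Function.Bijective (pairWord (K := K) (ι := ι) γ) := by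
  have : Module.Finite K F := Module.finite_of_finrank_pos (by omega)
  let φ : K × K →ₗ[K] F :=
    (Algebra.linearMap K F).coprod (LinearMap.mulLeft K γ ∘ₗ Algebra.linearMap K F)
  have hφ : Function.Bijective φ := by
    have hinj : Function.Injective φ := by
      rw [← LinearMap.ker_eq_bot, LinearMap.ker_eq_bot']
      rintro ⟨a, b⟩ h
      obtain ⟨rfl, rfl⟩ := (add_mul_eq_zero_iff hγ a b).mp h
      rfl
    exact ⟨hinj, (LinearMap.injective_iff_surjective_of_finrank_eq_finrank (by simp [hF])).mp hinj⟩
  constructor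
  · rw [injective_iff_map_eq_zero]
    intro x hx
    have := fun i => (add_mul_eq_zero_iff hγ (x.1 i) (x.2 i)).mp (congrFun hx i)
    exact Prod.ext (funext fun i => (this i).1) (funext fun i => (this i).2)
  · intro w
    choose g hg using fun i => hφ.2 (w i)
    exact ⟨(fun i => (g i).1, fun i => (g i).2), funext hg⟩

lemma errorWeight_eq_hammingNorm [DecidableEq F] (hγ : γ ^ Fintype.card K ≠ γ)
    (x : (ι → K) × (ι → K)) : errorWeight x.1 x.2 = hammingNorm (pairWord γ x) := by
  classical
  rw [errorWeight, Nat.card_eq_fintype_card, Fintype.card_subtype, hammingNorm]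
  congr 1
  ext i
  simp only [Finset.mem_filter, Finset.mem_univ, true_and]
  rw [pairWord_apply, ne_eq, ne_eq, add_mul_eq_zero_iff hγ, Prod.mk.injEq]

/-- The `K`-valued symplectic form underlying `symplForm`. -/
def kSymplForm (x y : (ι → K) × (ι → K)) : K := ∑ i, (x.2 i * y.1 i - y.2 i * x.1 i)

lemma symplForm_eq_trace (p : ℕ) [Fact p.Prime] [Algebra (ZMod p) K] (x y : (ι → K) × (ι → K)) :
    symplForm p x y = Algebra.trace (ZMod p) K (kSymplForm x y) := by
  rw [symplForm, trDot, trDot, ← map_sub, kSymplForm, Finset.sum_sub_distrib]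

/-- The terms without `γ` and those in `γ^(q+1)` are symmetric and cancel; the cross terms remain.
-/
lemma hermInner_sub_hermInner (x y : (ι → K) × (ι → K)) :
    hermInner K (pairWord γ x) (pairWord γ y) - hermInner K (pairWord γ y) (pairWord γ x)
      = (γ ^ Fintype.card K - γ) * algebraMap K F (kSymplForm x y) := by
  rw [hermInner, hermInner, ← Finset.sum_sub_distrib, kSymplForm, map_sum, Finset.mul_sum]
  refine Finset.sum_congr rfl fun i _ => ?_
  simp only [pairWord_apply, add_pow_card, mul_pow, algebraMap_pow_card, map_sub, map_mul]
  ring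

lemma hermInner_smul_left (r : F) (u v : ι → F) :
    hermInner K (r • u) v = r ^ Fintype.card K * hermInner K u v := by
  simp only [hermInner, Pi.smul_apply, smul_eq_mul, mul_pow, Finset.mul_sum, mul_assoc]

/-- For an `F`-linear code the trace-symplectic dual is the Hermitian dual. -/
lemma forall_symplForm_eq_zero_iff (p : ℕ) [Fact p.Prime] [Algebra (ZMod p) K]
    (hF : Module.finrank K F = 2) (hγ : γ ^ Fintype.card K ≠ γ)
    (C : Submodule F (ι → F)) (y : (ι → K) × (ι → K)) :
    (∀ e ∈ C.toAddSubgroup.comap (pairWord γ), symplForm p e y = 0)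
      ↔ pairWord γ y ∈ hermDual K C := by
  have hγ' : γ ^ Fintype.card K - γ ≠ 0 := sub_ne_zero.mpr hγ
  constructor
  · intro h c hc
    -- `K`-linearity removes the trace: if the form were nonzero at `e`, a multiple of `e` would
    -- give it the value `t`, of trace `1`.
    have hk : ∀ e : (ι → K) × (ι → K), pairWord γ e ∈ C → kSymplForm e y = 0 := by
      intro e he
      by_contra hne
      obtain ⟨t, ht⟩ := Algebra.trace_surjective (ZMod p) K 1
      have hz : pairWord γ ((t * (kSymplForm e y)⁻¹) • e) ∈ C := by
        have : pairWord γ ((t * (kSymplForm e y)⁻¹) • e)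
            = algebraMap K F (t * (kSymplForm e y)⁻¹) • pairWord γ e := by
          ext i
          simp only [pairWord_apply, Prod.smul_fst, Prod.smul_snd, Pi.smul_apply, smul_eq_mul,
            map_mul]
          ring
        rw [this]
        exact C.smul_mem _ he
      have hsmul : ∀ z : K, kSymplForm (z • e) y = z * kSymplForm e y := by
        intro z
        rw [kSymplForm, kSymplForm, Finset.mul_sum]
        refine Finset.sum_congr rfl fun i _ => ?_
        simp only [Prod.smul_fst, Prod.smul_snd, Pi.smul_apply, smul_eq_mul]
        ring
      have := h _ hz
      rw [symplForm_eq_trace, hsmul, inv_mul_cancel_right₀ hne, ht] at this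
      exact one_ne_zero this
    have hsymm : ∀ c ∈ C, hermInner K c (pairWord γ y) = hermInner K (pairWord γ y) c := by
      intro c hc
      obtain ⟨e, rfl⟩ := (pairWord_bijective hF hγ).2 c
      have := hermInner_sub_hermInner (γ := γ) e y
      rwa [hk e hc, map_zero, mul_zero, sub_eq_zero] at this
    -- Symmetry at both `c` and `γ • c` gives `γ^q H = γ H` for the product `H`, hence `H = 0`.
    have h1 := hsymm c hc
    have h2 := hsymm (γ • c) (C.smul_mem γ hc)
    rw [hermInner_smul_left, hermInner_smul_right, h1, ← sub_eq_zero, ← sub_mul] at h2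
    exact (mul_eq_zero.mp h2).resolve_left hγ'
  · intro h e he
    have h1 := h _ he
    have h2 := hermInner_sub_hermInner (γ := γ) e y
    rw [h1, hermInner_eq_zero_comm K hF h1, sub_zero, eq_comm, mul_eq_zero] at h2
    have h3 := (map_eq_zero _).mp (h2.resolve_left hγ')
    rw [symplForm_eq_trace, h3, map_zero]

lemma hermDual_eq_self_iff (hF : Module.finrank K F = 2) {C : Submodule F (ι → F)}
    (hC : C ≤ hermDual K C) :
    hermDual K C = C ↔ 2 * Module.finrank F C = Fintype.card ι := by
  have h := finrank_add_finrank_hermDual K hF C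
  constructor
  · intro he
    rw [he] at h
    omega
  · intro he
    exact (Submodule.eq_of_le_of_finrank_eq hC (by omega)).symm

/-- The Hermitian construction of stabilizer codes. -/
theorem exists_stabilizerCode_of_le_hermDual (p : ℕ) [Fact p.Prime] [Algebra (ZMod p) K]
    [DecidableEq ι] [DecidableEq F] (hF : Module.finrank K F = 2) {C : Submodule F (ι → F)}
    (hC : C ≤ hermDual K C) {n k d : ℕ} (hn : Fintype.card ι = n)
    (hk : k + 2 * Module.finrank F C = n)
    (hd : IsLeast (hammingNorm '' distanceWords K C) d) :
    ∃ Q : Submodule ℂ ((ι → K) → ℂ), IsStabilizerCodeWithParams p n k d Q := by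
  obtain ⟨γ, hγ⟩ := exists_pow_card_ne K hF
  have hbij := pairWord_bijective (ι := ι) hF hγ
  have hself := hermDual_eq_self_iff hF hC
  have hdual := forall_symplForm_eq_zero_iff p hF hγ C
  refine exists_isStabilizerCodeWithParams (C.toAddSubgroup.comap (pairWord γ)) ?_ hn ?_
    (fun hk0 => ?_) (fun hk0 => ?_) (fun hk0 x hx => ?_)
  · intro x hx y hy
    exact (hdual y).mpr (hC hy) x hx
  · have hcard : Nat.card (C.toAddSubgroup.comap (pairWord (K := K) γ)) = Nat.card C :=
      Nat.card_congr ((Equiv.ofBijective _ hbij).subtypeEquiv fun _ => Iff.rfl)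
    rw [hcard, Module.natCard_eq_pow_finrank (K := F), card_eq_card_sq K hF, ← pow_mul, ← pow_add,
      hk]
  -- By dimension, `k = 0` exactly when `C` is self-dual, so the two cases of `distanceWords` match
  -- those of the distance.
  · have hne : hermDual K C ≠ C := fun h => hk0 (by have := hself.mp h; omega)
    convert hd using 1
    ext w
    constructor
    · rintro ⟨x, hw, hx, hxC⟩
      exact ⟨pairWord γ x, ⟨(hdual x).mp hx, Or.inl hxC⟩,
        (errorWeight_eq_hammingNorm hγ x).symm.trans hw⟩
    · rintro ⟨c, ⟨hc, hcC⟩, hw⟩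
      obtain ⟨x, rfl⟩ := hbij.2 c
      exact ⟨x, (errorWeight_eq_hammingNorm hγ x).trans hw, (hdual x).mpr hc,
        hcC.resolve_right fun h => hne h.1⟩
  · have he : hermDual K C = C := hself.mpr (by omega)
    convert hd using 1
    ext w
    constructor
    · rintro ⟨x, hw, hx, hx0⟩
      exact ⟨pairWord γ x, ⟨(hdual x).mp hx, Or.inr ⟨he, (map_ne_zero_iff _ hbij.1).mpr hx0⟩⟩,
        (errorWeight_eq_hammingNorm hγ x).symm.trans hw⟩
    · rintro ⟨c, ⟨hc, hcC⟩, hw⟩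
      obtain ⟨x, rfl⟩ := hbij.2 c
      refine ⟨x, (errorWeight_eq_hammingNorm hγ x).trans hw, (hdual x).mpr hc, ?_⟩
      rcases hcC with h | h
      · exact absurd (he ▸ hc) h
      · exact (map_ne_zero_iff _ hbij.1).mp h.2
  · have he : hermDual K C = C := hself.mpr (by omega)
    have := (hdual x).mp hx
    rw [he] at this
    exact this

end HermitianStabilizer

end QCStab

end

theorem mainTheorem7 (p : ℕ) [Fact p.Prime]
    {K F : Type*} [Field K] [Fintype K] [Algebra (ZMod p) K]
    [Field F] [DecidableEq F] [Algebra K F] (hF : Module.finrank K F = 2)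
    (m : ℕ) (hm : 0 < m) (g₁ g₂ v₁ v₂ : F[X])
    (hg₁ : g₁.Monic) (hg₂ : g₂.Monic)
    (hd₁ : g₁ ∣ X ^ m - 1) (hd₂ : g₂ ∣ X ^ m - 1)
    (hv : IsCoprime (v₁ * v₂ - 1) (X ^ m - 1))
    (h1 : QCStab.coeffPow K (QCStab.parityPoly m g₁) ∣
      QCStab.bar m g₁ * (1 + QCStab.coeffPow K v₁ * QCStab.bar m v₁))
    (h2 : QCStab.coeffPow K (QCStab.parityPoly m g₁) ∣
      QCStab.bar m g₂ * (QCStab.bar m v₂ + QCStab.coeffPow K v₁))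
    (h3 : QCStab.coeffPow K (QCStab.parityPoly m g₂) ∣
      QCStab.bar m g₂ * (QCStab.coeffPow K v₂ * QCStab.bar m v₂ + 1)) :
    QCStab.twoGenCode m g₁ g₂ v₁ v₂ ≤ QCStab.hermDual K (QCStab.twoGenCode m g₁ g₂ v₁ v₂) ∧
    Module.finrank F (QCStab.twoGenCode m g₁ g₂ v₁ v₂)
      = 2 * m - g₁.natDegree - g₂.natDegree ∧
    m ≤ g₁.natDegree + g₂.natDegree ∧
    ∃ d : ℕ,
      IsLeast (hammingNorm '' QCStab.distanceWords K (QCStab.twoGenCode m g₁ g₂ v₁ v₂)) d ∧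
      ∃ Q : Submodule ℂ ((Fin 2 × Fin m → K) → ℂ),
        QCStab.IsStabilizerCodeWithParams p (2 * m)
          (2 * (g₁.natDegree + g₂.natDegree - m)) d Q := by
  have hC := QCStab.twoGenCode_le_hermDual K hF hm hd₁ hd₂ h1 h2 h3
  have hfin := QCStab.finrank_twoGenCode hm hg₁ hg₂ hd₁ hd₂ hv
  have hn₁ := QCStab.natDegree_add_natDegree_parityPoly hm hg₁ hd₁
  have hn₂ := QCStab.natDegree_add_natDegree_parityPoly hm hg₂ hd₂
  have hcard : Fintype.card (Fin 2 × Fin m) = 2 * m := by simp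
  have hdual := QCStab.finrank_add_finrank_hermDual K hF (QCStab.twoGenCode m g₁ g₂ v₁ v₂)
  have hle := Submodule.finrank_mono hC
  have : Nonempty (Fin 2 × Fin m) := ⟨(0, ⟨0, hm⟩)⟩
  obtain ⟨d, hd⟩ := QCStab.exists_isLeast_distanceWords K hF hC
  -- Complementary dimensions and `C ≤ C^{⊥_H}` give `dim C ≤ m`, which is the degree bound. With
  -- `deg g_i ≤ m`, no natural subtraction here truncates.
  exact ⟨hC, by omega, by omega, d, hd,
    QCStab.exists_stabilizerCode_of_le_hermDual p hF hC hcard (by omega) hd⟩
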